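/- For coprime integers $a, b$, let $\{G_n(a,b)\}_{n\ge 1}$ be the Gibonacci sequence given by $G_1(a,b)=a$, $G_2(a,b)=b$ and $G_{n+1}(a,b)=G_{n-1}(a,b)+G_n(a,b)$ for $n \ge 2$. For a positive integer $m$, the sequence is called complete mod $m$ if for every integer $r$ there is an $n\ge 1$ with $G_n(a,b)\equiv r \pmod m$. Let $a, b$ be integers with $\gcd(a,b)=1$ and $a^2+ab-b^2\not\equiv 0 \pmod 5$, and let $m$ be a positive integer (divisible by $5$ or not). If $\{G_n(a,b)\}$ is complete mod $m$, then $\{G_n(a,b)\}$ is complete mod $5m$. -/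

import Mathlib

/-- The sequence `G_n(a, b)` of integers with `G_1 = a`, `G_2 = b` and
`G_{n+1} = G_{n-1} + G_n`. Its terms are those of index `n ≥ 1`; the value at `0` is the
backward extension `b - a` of the recurrence and is never used as a term below. -/
def gibonacci (a b : ℤ) : ℕ → ℤ
  | 0 => b - a
  | 1 => a
  | 2 => b
  | n + 3 => gibonacci a b (n + 1) + gibonacci a b (n + 2)

/-- The sequence `u_1, u_2, u_3, …` is complete mod `m`: every residue class mod `m`
contains one of its terms. -/
def IsCompleteMod (u : ℕ → ℤ) (m : ℕ) : Prop :=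
  ∀ r : ℤ, ∃ n : ℕ, 1 ≤ n ∧ u n ≡ r [ZMOD (m : ℤ)]

/-! Consecutive terms form an element of `ℤ[φ]` that multiplication by `φ` shifts. Write `m = 5 ^ k
* d` with `5 ∤ d`. Completeness mod `d` gives `φ ^ P ≡ 1` mod `d` with `5 ∤ P`
(`exists_period_of_not_five_dvd`). From a term `G_n ≡ r` mod `m`, a shift by `4 * 5 ^ k * P * j`
keeps the residue mod `d` and adds `4 * 5 ^ k * P * j * g` mod `5 ^ (k + 1)`, where `g = 2 * G_{n+1}
- G_n` (`five_pow_succ_dvd_gibonacci_add_sub`). As `5 ∤ g`, some `j` gives `r` mod `5 * m`. -/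

open QuadraticAlgebra

/-- The ring `ℤ[φ]`, where `φ = ω` is the golden ratio. -/
abbrev GoldenRing : Type := QuadraticAlgebra ℤ 1 1

namespace GoldenRing

/-- The golden ratio. -/
abbrev phi : GoldenRing := omega

/-- The square root `2 φ - 1` of `5`. -/
abbrev sqrtFive : GoldenRing := 2 * phi - 1

theorem phi_mul_phi : phi * phi = 1 + phi := by
  ext <;> simp

theorem phi_mul_self_sub_one : phi * (phi - 1) = 1 := by
  linear_combination phi_mul_phi

theorem isUnit_phi : IsUnit phi := .of_mul_eq_one _ phi_mul_self_sub_one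

theorem sqrtFive_mul_self : sqrtFive * sqrtFive = 5 := by
  linear_combination 4 * phi_mul_phi

theorem intCast_dvd_re {d : ℤ} {x : GoldenRing} (h : (d : GoldenRing) ∣ x) : d ∣ x.re := by
  obtain ⟨c, rfl⟩ := h
  exact ⟨c.re, by simp⟩

theorem dvd_pow_sub_one_of_dvd {m : GoldenRing} {P Q : ℕ} (h : m ∣ phi ^ P - 1) (hPQ : P ∣ Q) :
    m ∣ phi ^ Q - 1 := by
  obtain ⟨k, rfl⟩ := hPQ
  rw [pow_mul]
  simpa using h.trans (sub_dvd_pow_sub_pow (phi ^ P) 1 k)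

/-- The action of Frobenius on the golden ratio modulo an odd prime. -/
theorem dvd_two_mul_phi_pow_sub (p : ℕ) [Fact p.Prime] (hp : p ≠ 2) :
    (p : GoldenRing) ∣ 2 * phi ^ p - (1 + (legendreSym p 5 : GoldenRing) * sqrtFive) := by
  have hprime : p.Prime := Fact.out
  have h2 : (p : ℤ) ∣ 2 ^ p - 2 := by
    rw [← ZMod.intCast_zmod_eq_zero_iff_dvd]
    push_cast
    rw [ZMod.pow_card, sub_self]
  have h5 : (p : ℤ) ∣ 5 ^ (p / 2) - legendreSym p 5 := by
    rw [← ZMod.intCast_zmod_eq_zero_iff_dvd]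
    push_cast
    rw [legendreSym.eq_pow, Int.cast_ofNat, sub_self]
  obtain ⟨u, hu⟩ := h2
  obtain ⟨v, hv⟩ := h5
  have hu' : (2 : GoldenRing) ^ p - 2 = p * u := by
    exact_mod_cast congrArg (Int.cast (R := GoldenRing)) hu
  have hv' : (5 : GoldenRing) ^ (p / 2) - legendreSym p 5 = p * v := by
    exact_mod_cast congrArg (Int.cast (R := GoldenRing)) hv
  obtain ⟨r, hr⟩ := exists_add_pow_prime_eq hprime (1 : GoldenRing) sqrtFive
  have hodd : p = 2 * (p / 2) + 1 := by
    have := Nat.odd_iff.mp (hprime.odd_of_ne_two hp)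
    lia
  have hs : sqrtFive ^ p = 5 ^ (p / 2) * sqrtFive := by
    conv_lhs => rw [hodd, pow_succ, pow_mul, pow_two, sqrtFive_mul_self]
  have hsum : (1 + sqrtFive) ^ p = 2 ^ p * phi ^ p := by
    rw [← mul_pow, add_sub_cancel]
  rw [hsum, hs, one_pow] at hr
  exact ⟨v * sqrtFive + sqrtFive * r - u * phi ^ p, by
    linear_combination hr - phi ^ p * hu' + sqrtFive * hv'⟩

theorem isCoprime_natCast_two {p : ℕ} (hp : p.Prime) (h2 : p ≠ 2) :
    IsCoprime (p : GoldenRing) 2 := by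
  have h : p.Coprime 2 := (Nat.coprime_primes hp Nat.prime_two).2 h2
  exact_mod_cast (Nat.isCoprime_iff_coprime.2 h).map (Int.castRingHom GoldenRing)

theorem dvd_phi_pow_pred_sub_one (p : ℕ) [Fact p.Prime] (hp : p ≠ 2) (h : legendreSym p 5 = 1) :
    (p : GoldenRing) ∣ phi ^ (p - 1) - 1 := by
  have hprime : p.Prime := Fact.out
  have key := dvd_two_mul_phi_pow_sub p hp
  obtain ⟨q, rfl⟩ := Nat.exists_eq_add_one.2 hprime.pos
  rw [h] at key
  have e : 2 * phi ^ (q + 1) - (1 + ((1 : ℤ) : GoldenRing) * sqrtFive) =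
      2 * (phi * (phi ^ q - 1)) := by
    push_cast; ring
  rw [e] at key
  exact isUnit_phi.dvd_mul_left.1 ((isCoprime_natCast_two hprime hp).dvd_of_dvd_mul_left key)

/-- Frobenius conjugates `φ` here, so `φ ^ (p + 1)` is the norm `-1` mod `p`. -/
theorem dvd_phi_pow_two_mul_succ_sub_one (p : ℕ) [Fact p.Prime] (hp : p ≠ 2)
    (h : legendreSym p 5 = -1) : (p : GoldenRing) ∣ phi ^ (2 * (p + 1)) - 1 := by
  have hprime : p.Prime := Fact.out
  have key := dvd_two_mul_phi_pow_sub p hp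
  rw [h] at key
  have e : 2 * phi ^ p - (1 + ((-1 : ℤ) : GoldenRing) * sqrtFive) =
      2 * (phi ^ p - (1 - phi)) := by
    push_cast; ring
  rw [e] at key
  have key' := (isCoprime_natCast_two hprime hp).dvd_of_dvd_mul_left key
  have e' : phi ^ (2 * (p + 1)) - 1 = (phi ^ p - (1 - phi)) * (phi * (phi ^ (p + 1) - 1)) := by
    have := phi_mul_self_sub_one
    linear_combination (1 - phi ^ (p + 1)) * this
  rw [e']
  exact key'.mul_right _

theorem dvd_phi_pow_prime_pow {p : ℕ} {P : ℕ} (h : (p : GoldenRing) ∣ phi ^ P - 1) (k : ℕ) :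
    ((p ^ (k + 1) : ℕ) : GoldenRing) ∣ phi ^ (P * p ^ k) - 1 := by
  rw [pow_mul]
  simpa using dvd_sub_pow_of_dvd_sub h k

theorem exists_one_add_five_pow_mul_pow {x z : GoldenRing} (hx : x * x = 5 * z) (k q : ℕ) :
    ∃ y : GoldenRing, (1 + 5 ^ k * x) ^ q = 1 + 5 ^ k * (q * x + 5 * y) := by
  induction q with
  | zero => exact ⟨0, by simp⟩
  | succ q ih =>
    obtain ⟨y, hy⟩ := ih
    refine ⟨y + 5 ^ k * (q * z + x * y), ?_⟩
    rw [pow_succ, hy]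
    push_cast
    linear_combination 5 ^ k * 5 ^ k * q * hx

theorem exists_phi_pow_four_mul_five_pow (k : ℕ) :
    ∃ y : GoldenRing, phi ^ (4 * 5 ^ k) = 1 + 5 ^ k * (4 * sqrtFive + 5 * y) := by
  induction k with
  | zero =>
    refine ⟨1 - phi, ?_⟩
    have := phi_mul_phi
    simp only [pow_zero, mul_one, one_mul]
    linear_combination (phi * phi + phi + 2) * this
  | succ k ih =>
    obtain ⟨y, hy⟩ := ih
    have hs := sqrtFive_mul_self
    set s := sqrtFive
    set x := 4 * s + 5 * y with hxdef
    have hx : x * x = 5 * (16 + 8 * s * y + 5 * (y * y)) := by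
      rw [hxdef]; linear_combination 16 * hs
    generalize (16 + 8 * s * y + 5 * (y * y)) = z at hx
    set t : GoldenRing := 5 ^ k
    -- Binomial expansion of `(1 + t * x) ^ 5`, with `x ^ 2` replaced by `5 * z`.
    refine ⟨y + 2 * t * z + 2 * t ^ 2 * z * x + t ^ 3 * (5 * z ^ 2) + t ^ 4 * z ^ 2 * x, ?_⟩
    rw [pow_succ, ← mul_assoc, pow_mul, hy, pow_succ]
    linear_combination (10 * t ^ 2 + 10 * t ^ 3 * x + t ^ 4 * 5 * (x * x + 5 * z)
      + t ^ 5 * x * (x * x + 5 * z)) * hx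

/-- The powers of `φ ^ (4 * 5 ^ k)` to first order at `5`. -/
theorem exists_phi_pow_four_mul_five_pow_mul (k q : ℕ) :
    ∃ y : GoldenRing, phi ^ (4 * 5 ^ k * q) = 1 + 5 ^ k * (4 * q * sqrtFive + 5 * y) := by
  obtain ⟨y, hy⟩ := exists_phi_pow_four_mul_five_pow k
  have hx : (4 * sqrtFive + 5 * y) * (4 * sqrtFive + 5 * y) =
      5 * (16 + 8 * sqrtFive * y + 5 * (y * y)) := by
    linear_combination 16 * sqrtFive_mul_self
  obtain ⟨w, hw⟩ := exists_one_add_five_pow_mul_pow hx k q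
  refine ⟨q * y + w, ?_⟩
  rw [pow_mul, hy, hw]
  ring

end GoldenRing

open GoldenRing

theorem gibonacci_add_two (a b : ℤ) (n : ℕ) :
    gibonacci a b (n + 2) = gibonacci a b n + gibonacci a b (n + 1) := by
  cases n with
  | zero => simp [gibonacci]
  | succ n => rw [gibonacci]

/-- Two consecutive terms of the sequence, as an element of `ℤ[φ]`. -/
def gibonacciPair (a b : ℤ) (n : ℕ) : GoldenRing := ⟨gibonacci a b n, gibonacci a b (n + 1)⟩

theorem phi_mul_gibonacciPair (a b : ℤ) (n : ℕ) :
    phi * gibonacciPair a b n = gibonacciPair a b (n + 1) := by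
  ext <;> simp [gibonacciPair, gibonacci_add_two]

theorem phi_pow_mul_gibonacciPair (a b : ℤ) (n k : ℕ) :
    phi ^ k * gibonacciPair a b n = gibonacciPair a b (n + k) := by
  induction k with
  | zero => simp
  | succ k ih =>
    rw [pow_succ', mul_assoc, ih, phi_mul_gibonacciPair, add_assoc]

theorem dvd_gibonacci_add_sub (a b : ℤ) {d : ℤ} {P : ℕ} (h : (d : GoldenRing) ∣ phi ^ P - 1)
    (n : ℕ) : d ∣ gibonacci a b (n + P) - gibonacci a b n := by
  have := intCast_dvd_re (h.mul_right (gibonacciPair a b n))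
  rwa [sub_mul, one_mul, phi_pow_mul_gibonacciPair] at this

/-- Mod 5 this quantity triples at each step, and `a ^ 2 + a * b - b ^ 2 ≡ -(3 * a - b) ^ 2`. -/
theorem not_five_dvd_two_mul_gibonacci_succ_sub {a b : ℤ}
    (hinv : ¬ a ^ 2 + a * b - b ^ 2 ≡ 0 [ZMOD 5]) (n : ℕ) :
    ¬ 5 ∣ 2 * gibonacci a b (n + 1) - gibonacci a b n := by
  induction n with
  | zero =>
    contrapose! hinv
    obtain ⟨c, hc⟩ : (5 : ℤ) ∣ 2 * a - (b - a) := hinv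
    refine Int.modEq_zero_iff_dvd.2 ⟨-a ^ 2 + 5 * a * c - 5 * c ^ 2, ?_⟩
    obtain rfl : b = 3 * a - 5 * c := by linarith
    ring
  | succ n ih =>
    rw [gibonacci_add_two]
    lia

theorem IsCompleteMod.of_dvd {u : ℕ → ℤ} {m d : ℕ} (h : IsCompleteMod u m) (hd : d ∣ m) :
    IsCompleteMod u d := fun r =>
  let ⟨n, hn, hr⟩ := h r
  ⟨n, hn, hr.of_dvd (Int.natCast_dvd_natCast.2 hd)⟩

theorem IsCompleteMod.le_period {a b : ℤ} {m P : ℕ} (hm : 0 < m) (hP : 0 < P)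
    (h : IsCompleteMod (gibonacci a b) m) (hper : (m : GoldenRing) ∣ phi ^ P - 1) : m ≤ P := by
  have : NeZero m := ⟨hm.ne'⟩
  have hsurj : Function.Surjective fun i : Fin P => (gibonacci a b i : ZMod m) := by
    intro z
    obtain ⟨r, rfl⟩ := ZMod.intCast_surjective z
    obtain ⟨n, -, hn⟩ := h r
    refine ⟨⟨n % P, Nat.mod_lt _ hP⟩, ?_⟩
    rw [← (ZMod.intCast_eq_intCast_iff _ _ _).2 hn]
    have hd := dvd_gibonacci_add_sub a b (d := m) (P := P * (n / P))
      (by exact_mod_cast dvd_pow_sub_one_of_dvd hper (dvd_mul_right _ _)) (n % P)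
    rw [Nat.mod_add_div] at hd
    exact (ZMod.intCast_eq_intCast_iff_dvd_sub _ _ _).2 hd
  simpa using Fintype.card_le_of_surjective _ hsurj

/-- If 5 is a square mod an odd `p`, the period `p - 1` is too short for completeness. Otherwise `2
* (p + 1)` is a period, and `5 ∣ p + 1` would make `p ≡ 2 ^ 2` a square mod 5, against reciprocity.
-/
theorem exists_period_of_prime {a b : ℤ} {p : ℕ} (hp : p.Prime) (hp5 : p ≠ 5)
    (h : IsCompleteMod (gibonacci a b) p) :
    ∃ P : ℕ, ¬ 5 ∣ P ∧ (p : GoldenRing) ∣ phi ^ P - 1 := by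
  have : Fact p.Prime := ⟨hp⟩
  rcases eq_or_ne p 2 with rfl | hp2
  · refine ⟨3, by norm_num, phi, ?_⟩
    have := phi_mul_phi
    push_cast
    linear_combination (phi + 1) * this
  have hdvd : ¬ 5 ∣ p := fun hd => hp5 ((Nat.prime_dvd_prime_iff_eq Nat.prime_five hp).1 hd).symm
  have hne : ((5 : ℤ) : ZMod p) ≠ 0 := by
    rw [Ne, ZMod.intCast_zmod_eq_zero_iff_dvd]
    norm_cast
    exact fun hd => hp5 ((Nat.prime_dvd_prime_iff_eq hp Nat.prime_five).1 hd)
  rcases legendreSym.eq_one_or_neg_one p hne with h1 | h1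
  · have := h.le_period hp.pos (Nat.sub_pos_of_lt hp.one_lt) (dvd_phi_pow_pred_sub_one p hp2 h1)
    have := hp.pos
    lia
  · refine ⟨2 * (p + 1), fun hd => ?_, dvd_phi_pow_two_mul_succ_sub_one p hp2 h1⟩
    have : Fact (Nat.Prime 5) := ⟨Nat.prime_five⟩
    have hrec := legendreSym.quadratic_reciprocity_one_mod_four (p := 5) (q := p) (by norm_num) hp2
    have hne2 : ((2 : ℤ) : ZMod 5) ≠ 0 := by
      rw [Ne, ZMod.intCast_zmod_eq_zero_iff_dvd]
      norm_num
    have h4 : (p : ℤ) % 5 = 4 := by lia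
    rw [Nat.cast_ofNat, h1, legendreSym.mod, Nat.cast_ofNat, h4,
      show (4 : ℤ) = 2 ^ 2 by norm_num, legendreSym.sq_one' 5 hne2] at hrec
    norm_num at hrec

theorem exists_period_of_not_five_dvd {a b : ℤ} (m : ℕ) :
    ¬ 5 ∣ m → IsCompleteMod (gibonacci a b) m →
      ∃ P : ℕ, ¬ 5 ∣ P ∧ (m : GoldenRing) ∣ phi ^ P - 1 := by
  induction m using Nat.recOnPosPrimePosCoprime with
  | zero => exact fun h => absurd (dvd_zero 5) h
  | one => exact fun _ _ => ⟨1, by norm_num, by simp⟩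
  | prime_pow p n hp hn =>
    intro h5 h
    obtain ⟨k, rfl⟩ := Nat.exists_eq_add_one.2 hn
    have hp5 : p ≠ 5 := by
      rintro rfl
      exact h5 (dvd_pow_self 5 hn.ne')
    obtain ⟨P, hP, hd⟩ := exists_period_of_prime hp hp5 (h.of_dvd (dvd_pow_self p hn.ne'))
    refine ⟨P * p ^ k, fun hdvd => ?_, dvd_phi_pow_prime_pow hd k⟩
    rcases Nat.prime_five.dvd_mul.1 hdvd with h' | h'
    · exact hP h'
    · exact h5 (h'.trans (pow_dvd_pow p k.le_succ))
  | coprime c d _ _ hcd ihc ihd =>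
    intro h5 h
    obtain ⟨P, hP, hPd⟩ := ihc (fun hc => h5 (hc.mul_right d)) (h.of_dvd (dvd_mul_right c d))
    obtain ⟨Q, hQ, hQd⟩ := ihd (fun hd => h5 (hd.mul_left c)) (h.of_dvd (dvd_mul_left d c))
    refine ⟨P * Q, fun hdvd => (Nat.prime_five.dvd_mul.1 hdvd).elim hP hQ, ?_⟩
    have hco : IsCoprime (c : GoldenRing) d := by
      exact_mod_cast (Nat.isCoprime_iff_coprime.2 hcd).map (Int.castRingHom GoldenRing)
    push_cast
    exact hco.mul_dvd (dvd_pow_sub_one_of_dvd hPd (dvd_mul_right P Q))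
      (dvd_pow_sub_one_of_dvd hQd (dvd_mul_left Q P))

/-- The terms at distance `4 * 5 ^ k * q` to first order at `5`. -/
theorem five_pow_succ_dvd_gibonacci_add_sub (a b : ℤ) (n k q : ℕ) :
    (5 : ℤ) ^ (k + 1) ∣ gibonacci a b (n + 4 * 5 ^ k * q) - gibonacci a b n -
      5 ^ k * (4 * q * (2 * gibonacci a b (n + 1) - gibonacci a b n)) := by
  obtain ⟨y, hy⟩ := exists_phi_pow_four_mul_five_pow_mul k q
  have h : gibonacciPair a b (n + 4 * 5 ^ k * q) - gibonacciPair a b n -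
      ((5 ^ k * (4 * q) : ℤ) : GoldenRing) * (sqrtFive * gibonacciPair a b n) =
      ((5 ^ (k + 1) : ℤ) : GoldenRing) * (y * gibonacciPair a b n) := by
    rw [← phi_pow_mul_gibonacciPair, hy]
    push_cast
    ring
  have h' := intCast_dvd_re (Dvd.intro _ h.symm)
  have e : (sqrtFive * gibonacciPair a b n).re =
      2 * gibonacci a b (n + 1) - gibonacci a b n := by
    simp [gibonacciPair]
    ring
  simp only [re_sub, re_mul, re_intCast, im_intCast, e] at h'
  convert h' using 1
  simp [gibonacciPair]
  ring

theorem exists_five_dvd_natCast_mul_sub {h : ℤ} (hh : ¬ 5 ∣ h) (e : ℤ) :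
    ∃ j : ℕ, 5 ∣ j * h - e := by
  have : Fact (Nat.Prime 5) := ⟨Nat.prime_five⟩
  have hne : (h : ZMod 5) ≠ 0 := fun h0 => hh ((ZMod.intCast_zmod_eq_zero_iff_dvd h 5).1 h0)
  refine ⟨((e : ZMod 5) / h).val, (ZMod.intCast_zmod_eq_zero_iff_dvd _ 5).1 ?_⟩
  push_cast
  rw [ZMod.natCast_zmod_val, div_mul_cancel₀ _ hne, sub_self]

theorem mainTheorem5 (a b : ℤ) (hab : IsCoprime a b)
    (hinv : ¬ a ^ 2 + a * b - b ^ 2 ≡ 0 [ZMOD 5])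
    (m : ℕ) (hm : 0 < m) (hcomplete : IsCompleteMod (gibonacci a b) m) :
    IsCompleteMod (gibonacci a b) (5 * m) := by
  intro r
  obtain ⟨k, d, hd5, rfl⟩ := Nat.exists_eq_pow_mul_and_not_dvd hm.ne' 5 (by norm_num)
  obtain ⟨P, hP5, hP⟩ := exists_period_of_not_five_dvd d hd5
    (hcomplete.of_dvd (dvd_mul_left d (5 ^ k)))
  obtain ⟨n, hn, hnr⟩ := hcomplete r
  obtain ⟨e, he⟩ := hnr.dvd
  push_cast at he
  set g := 2 * gibonacci a b (n + 1) - gibonacci a b n with hg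
  have hg5 : ¬ 5 ∣ g := not_five_dvd_two_mul_gibonacci_succ_sub hinv n
  have hcoef : ¬ (5 : ℤ) ∣ 4 * P * g := by
    have h5 : Prime (5 : ℤ) := by norm_num
    rw [h5.dvd_mul, h5.dvd_mul]
    rintro ((h | h) | h)
    · revert h; decide
    · exact hP5 (by exact_mod_cast h)
    · exact hg5 h
  -- The defect to cancel is `r - G_n = 5 ^ k * (d * e)`.
  obtain ⟨j, c, hj⟩ := exists_five_dvd_natCast_mul_sub hcoef (d * e)
  refine ⟨n + 4 * 5 ^ k * (P * j), by lia, Int.ModEq.symm (Int.modEq_iff_dvd.2 ?_)⟩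
  have hfive : (5 : ℤ) ^ (k + 1) ∣ gibonacci a b (n + 4 * 5 ^ k * (P * j)) - r := by
    obtain ⟨y, hy⟩ := five_pow_succ_dvd_gibonacci_add_sub a b n k (P * j)
    rw [← hg] at hy
    push_cast at hy
    exact ⟨y + c, by linear_combination hy - he + 5 ^ k * hj⟩
  have hrest : (d : ℤ) ∣ gibonacci a b (n + 4 * 5 ^ k * (P * j)) - r := by
    have hper := dvd_gibonacci_add_sub a b (d := d) (P := 4 * 5 ^ k * (P * j))
      (by exact_mod_cast dvd_pow_sub_one_of_dvd hP ⟨4 * 5 ^ k * j, by ring⟩) n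
    obtain ⟨y, hy⟩ := hper
    exact ⟨y - 5 ^ k * e, by linear_combination hy - he⟩
  have hco : IsCoprime ((5 : ℤ) ^ (k + 1)) d := by
    have : Nat.Coprime (5 ^ (k + 1)) d :=
      Nat.Coprime.pow_left _ ((Nat.prime_five.coprime_iff_not_dvd).2 hd5)
    exact_mod_cast Nat.isCoprime_iff_coprime.2 this
  have hall := hco.mul_dvd hfive hrest
  push_cast
  rwa [← mul_assoc, ← pow_succ']
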